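/- Let $G=(U,V)$ be a finite simple plane bipartite graph with colour classes $U,V$ and $|U|=|V|$, in which every edge $f$ carries a weight $\omega_f$ (in a commutative ring, for instance a real number or an indeterminate). For a graph $H$ obtained from $G$ by deleting vertices (with their incident edges) and edges, let $M(H)$ denote the sum, over all perfect matchings of $H$, of the product of the weights of the edges in the matching (an empty product being $1$). Let $a_1$ and $b_1$ be two vertices of $G$ of different colours and let $e=a_2b_2$ be an edge of $G$, and suppose that $a_1,b_1,a_2,b_2$ are four distinct vertices that appear in this cyclic order on a face of $G$, that is, some closed topological disc is contained in that face except for four points of its boundary circle, which are, in this cyclic order, $a_1,b_1,a_2,b_2$. (i) If $\{a_1,b_2\}\subseteq U$ and $\{a_2,b_1\}\subseteq V$, or $\{a_1,b_2\}\subseteq V$ and $\{a_2,b_1\}\subseteq U$, then $$M(G)\,M(G-a_1-b_1-e)=M(G-a_1-b_1)\,M(G-e)+\omega_e\,M(G-a_1-a_2)\,M(G-b_1-b_2).$$ (ii) If $\{a_1,a_2\}\subseteq U$ and $\{b_1,b_2\}\subseteq V$, or $\{a_1,a_2\}\subseteq V$ and $\{b_1,b_2\}\subseteq U$, then $$M(G)\,M(G-a_1-b_1-e)=M(G-a_1-b_1)\,M(G-e)-\omega_e\,M(G-a_2-b_1)\,M(G-a_1-b_2).$$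 -/

import Mathlib

/-- A drawing of a simple graph `G` in the plane `ℂ` without crossings; a graph together with such
a drawing is a plane graph.  The values of `arc` off the edge set of `G` play no role. -/
structure PlaneDrawing {α : Type*} (G : SimpleGraph α) where
  /-- the point that represents a vertex -/
  pos : α → ℂ
  /-- the set of points (end points included) that represents an edge -/
  arc : Sym2 α → Set ℂ
  pos_injective : Function.Injective pos
  /-- every edge is a simple arc that joins its two end vertices -/
  isArc : ∀ u v, G.Adj u v →
    ∃ γ : Path (pos u) (pos v), Function.Injective γ ∧ Set.range γ = arc s(u, v)
  /-- an edge passes through no vertex other than its end vertices -/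
  mem_of_pos_mem_arc : ∀ e ∈ G.edgeSet, ∀ v, pos v ∈ arc e → v ∈ e
  /-- two different edges meet at most in vertices -/
  arc_inter_arc_subset : ∀ e ∈ G.edgeSet, ∀ f ∈ G.edgeSet, e ≠ f → arc e ∩ arc f ⊆ Set.range pos

namespace PlaneDrawing

variable {α : Type*} {G : SimpleGraph α}

/-- The set of all points of the plane that lie on the drawing. -/
def support (D : PlaneDrawing G) : Set ℂ :=
  Set.range D.pos ∪ ⋃ e ∈ G.edgeSet, D.arc e

/-- The faces are the connected components of the complement of the drawing. -/
def IsFace (D : PlaneDrawing G) (F : Set ℂ) : Prop :=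
  ∃ x ∈ D.supportᶜ, F = connectedComponentIn D.supportᶜ x

/-- The vertices `a, b, c, d` appear in this cyclic order (clockwise or counterclockwise) on the
face `F`: some closed topological disc lies in `F` except for four points of its boundary circle,
and these four points are, in cyclic order, the vertices `a, b, c, d`.
If the boundary of `F` is a simple closed curve, this says that `a, b, c, d` are four different
points of that curve in this cyclic order; in general it says that they occur in this cyclic order
at four corners of `F` met on going round the boundary of `F` (a vertex may have several
corners in `F`). The disc cannot be replaced by its boundary circle alone, because a closed curve
whose arcs lie in `F` can have parts of the graph on both of its sides. -/
def CyclicOnFace (D : PlaneDrawing G) (F : Set ℂ) (a b c d : α) : Prop :=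
  ∃ h : ℂ → ℂ,
    ContinuousOn h (Metric.closedBall 0 1) ∧
    Set.InjOn h (Metric.closedBall 0 1) ∧
    h 1 = D.pos a ∧ h Complex.I = D.pos b ∧ h (-1) = D.pos c ∧ h (-Complex.I) = D.pos d ∧
    ∀ z ∈ Metric.closedBall (0 : ℂ) 1,
      z ∉ ({1, Complex.I, -1, -Complex.I} : Set ℂ) → h z ∈ F

end PlaneDrawing

/-- `P` is a perfect matching of the graph `H`: a set of independent edges of `H` covering all
vertices of `H`. Here `H` is given as a subgraph of an ambient graph `G`. -/
structure IsPerfectMatchingSet {α : Type*} {G : SimpleGraph α} (H : G.Subgraph)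
    (P : Finset (Sym2 α)) : Prop where
  subset_edgeSet : ∀ e ∈ P, e ∈ H.edgeSet
  independent : ∀ e ∈ P, ∀ f ∈ P, e ≠ f → ∀ v, v ∈ e → v ∉ f
  covers : ∀ v ∈ H.verts, ∃ e ∈ P, v ∈ e

open Classical in
/-- `M(H)`: the sum, over the perfect matchings of `H`, of the product of the weights of the edges
of the matching. The weight of the edge `e` is `w e`. -/
noncomputable def matchingSum {α : Type*} [Fintype α] {R : Type*} [CommRing R]
    {G : SimpleGraph α} (w : Sym2 α → R) (H : G.Subgraph) : R :=
  ∑ P : Finset (Sym2 α) with IsPerfectMatchingSet H P, ∏ e ∈ P, w e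

/-!
Expand `M(G)` and `M(G - a₁ - b₁)` over the perfect matchings that avoid `e` and those that contain
`e`. This reduces the claim to the graphical condensation identity: if `a, b, c, d` occur in this
cyclic order on a face, then
`M(G) M(G - a - b - c - d) + M(G - a - c) M(G - b - d) =
  M(G - a - b) M(G - c - d) + M(G - a - d) M(G - b - c)`.
In the superposition of the two matchings counted by one of these products, the component of `a` is
a path that ends in another one of the four vertices. It does not end in `c`: otherwise the
component of `b` would be a path from `b` to `d`, disjoint from the first one, which is impossible
in the plane. So the path leads to `b` or to `d`, and exchanging the two matchings along it gives
weight-preserving bijections between the pairs counted by the two sides. In the bipartite case one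
term vanishes, because deleting two vertices of the same colour unbalances the colour classes.

Why disjoint paths `A` from `a` to `c` and `B` from `b` to `d` cannot exist: let `A'` and `B'` be
the images of the diameters of the disc with the same ends. On each side of the unit square, one of
the two terms of `A x - B y` is constant, so the winding numbers along the boundary satisfy
`n(A, B) + n(A', B') = n(A, B') + n(A', B)`. The number of a pair of disjoint paths is zero, because
the difference then has no zero on the square. But `A', B'` is the only one of the four pairs that
meets, and `n(A', B')` is odd: moving the two points of the disc to antipodal position deforms the
difference to an odd function without passing through zero on the boundary.
-/

section WindingNumber

open unitInterval

theorem exists_continuous_log_square {f : I × I → ℂ} (hf : Continuous f) (hf₀ : ∀ p, f p ≠ 0) :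
    ∃ l : I × I → ℂ, Continuous l ∧ ∀ p, Complex.exp (l p) = f p := by
  -- `I × I` is a retract of the plane, which is simply connected.
  let r : ℝ × ℝ → I × I := Prod.map (Set.projIcc 0 1 zero_le_one) (Set.projIcc 0 1 zero_le_one)
  have hr : Continuous r := continuous_projIcc.prodMap continuous_projIcc
  obtain ⟨l, ⟨-, hl⟩, -⟩ := Complex.isCoveringMapOn_exp.existsUnique_continuousMap_lifts
    (⟨f ∘ r, hf.comp hr⟩ : C(ℝ × ℝ, ℂ)) (a₀ := (0, 0))
    (Complex.exp_log (hf₀ (r (0, 0)))) (fun p ↦ hf₀ (r p))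
  refine ⟨fun p ↦ l (p.1, p.2), by fun_prop, fun p ↦ ?_⟩
  simpa [r] using congrFun hl ((p.1 : ℝ), (p.2 : ℝ))

theorem exists_continuous_log {f : I → ℂ} (hf : Continuous f) (hf₀ : ∀ x, f x ≠ 0) :
    ∃ l : I → ℂ, Continuous l ∧ ∀ x, Complex.exp (l x) = f x := by
  obtain ⟨l, hl, hlf⟩ := exists_continuous_log_square (hf.comp continuous_fst) (fun p ↦ hf₀ p.1)
  exact ⟨fun x ↦ l (x, 0), by fun_prop, fun x ↦ hlf (x, 0)⟩

theorem sub_eq_sub_of_exp_eq_exp {l m : I → ℂ} (hl : Continuous l) (hm : Continuous m)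
    (h : ∀ x, Complex.exp (l x) = Complex.exp (m x)) (x y : I) : l x - l y = m x - m y := by
  have hconst : (fun x ↦ l x - m x) = fun _ ↦ l y - m y :=
    Complex.isCoveringMap_exp.eq_of_comp_eq (by fun_prop) (by fun_prop)
      (by ext x; simp [Complex.exp_sub, h]) y rfl
  linear_combination congrFun hconst x

open Classical in
/-- The variation along `[0, 1]` of a continuous logarithm of `f`. It does not depend on the choice
of the logarithm, and is set to `0` when there is none. -/
noncomputable def logVariation (f : I → ℂ) : ℂ :=
  if h : ∃ l : I → ℂ, Continuous l ∧ ∀ x, Complex.exp (l x) = f x then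
    h.choose 1 - h.choose 0
  else 0

theorem logVariation_eq {f l : I → ℂ} (hl : Continuous l) (hlf : ∀ x, Complex.exp (l x) = f x) :
    logVariation f = l 1 - l 0 := by
  have h : ∃ l : I → ℂ, Continuous l ∧ ∀ x, Complex.exp (l x) = f x := ⟨l, hl, hlf⟩
  rw [logVariation, dif_pos h]
  exact sub_eq_sub_of_exp_eq_exp h.choose_spec.1 hl (fun x ↦ by rw [h.choose_spec.2, hlf]) 1 0

theorem exp_logVariation {f : I → ℂ} (hf : Continuous f) (hf₀ : ∀ x, f x ≠ 0) :
    Complex.exp (logVariation f) = f 1 / f 0 := by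
  obtain ⟨l, hl, hlf⟩ := exists_continuous_log hf hf₀
  rw [logVariation_eq hl hlf, Complex.exp_sub, hlf, hlf]

theorem logVariation_neg_symm {f : I → ℂ} (hf : Continuous f) (hf₀ : ∀ x, f x ≠ 0) :
    logVariation (fun x ↦ -f (σ x)) = -logVariation f := by
  obtain ⟨l, hl, hlf⟩ := exists_continuous_log hf hf₀
  rw [logVariation_eq hl hlf,
    logVariation_eq (l := fun x ↦ l (σ x) + Real.pi * Complex.I) (by fun_prop)
      (by simp [Complex.exp_add, hlf])]
  simp

/-- The variation of a continuous logarithm of `f` along the boundary of the unit square, traversed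
counterclockwise: `2πi` times the winding number of `f` around `0`. -/
noncomputable def boundaryLogVariation (f : I × I → ℂ) : ℂ :=
  logVariation (fun x ↦ f (x, 0)) + logVariation (fun y ↦ f (1, y)) -
    logVariation (fun x ↦ f (x, 1)) - logVariation (fun y ↦ f (0, y))

/-- The union of the four sides of the unit square, on which functions are required not to vanish
for their winding number to make sense. -/
def squareBoundary : Set (I × I) :=
  {p | p.1 = 0 ∨ p.1 = 1 ∨ p.2 = 0 ∨ p.2 = 1}

theorem boundaryLogVariation_eq_zero {f : I × I → ℂ} (hf : Continuous f) (hf₀ : ∀ p, f p ≠ 0) :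
    boundaryLogVariation f = 0 := by
  obtain ⟨l, hl, hlf⟩ := exists_continuous_log_square hf hf₀
  rw [boundaryLogVariation,
    logVariation_eq (l := fun x ↦ l (x, 0)) (by fun_prop) fun x ↦ hlf _,
    logVariation_eq (l := fun y ↦ l (1, y)) (by fun_prop) fun y ↦ hlf _,
    logVariation_eq (l := fun x ↦ l (x, 1)) (by fun_prop) fun x ↦ hlf _,
    logVariation_eq (l := fun y ↦ l (0, y)) (by fun_prop) fun y ↦ hlf _]
  ring

theorem boundaryLogVariation_eq_of_homotopy {H : I → I × I → ℂ}
    (hH : Continuous fun q : I × I × I ↦ H q.1 q.2)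
    (hH₀ : ∀ k, ∀ p ∈ squareBoundary, H k p ≠ 0) :
    boundaryLogVariation (H 0) = boundaryLogVariation (H 1) := by
  have side (γ : I → I × I) (hγ : Continuous γ) (hγb : ∀ x, γ x ∈ squareBoundary) :
      logVariation (fun x ↦ H 0 (γ x)) + logVariation (fun k ↦ H k (γ 1)) -
        logVariation (fun x ↦ H 1 (γ x)) - logVariation (fun k ↦ H k (γ 0)) = 0 :=
    boundaryLogVariation_eq_zero (f := fun p ↦ H p.2 (γ p.1))
      (hH.comp (by fun_prop : Continuous fun p : I × I ↦ (p.2, γ p.1))) fun p ↦ hH₀ _ _ (hγb _)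
  have bottom := side (fun x ↦ (x, 0)) (by fun_prop) (by simp [squareBoundary])
  have right := side (fun y ↦ (1, y)) (by fun_prop) (by simp [squareBoundary])
  have top := side (fun x ↦ (x, 1)) (by fun_prop) (by simp [squareBoundary])
  have left := side (fun y ↦ (0, y)) (by fun_prop) (by simp [squareBoundary])
  unfold boundaryLogVariation
  linear_combination bottom + right - top - left

/-- Opposite sides of the square contribute equally, and two adjacent ones together join a point to
its negative. -/
theorem boundaryLogVariation_ne_zero_of_odd {f : I × I → ℂ} (hf : Continuous f)
    (hf₀ : ∀ p ∈ squareBoundary, f p ≠ 0) (hodd : ∀ x y, f (σ x, σ y) = -f (x, y)) :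
    boundaryLogVariation f ≠ 0 := by
  have bottom₀ (x : I) : f (x, 0) ≠ 0 := hf₀ _ (by simp [squareBoundary])
  have left₀ (y : I) : f (0, y) ≠ 0 := hf₀ _ (by simp [squareBoundary])
  have top : logVariation (fun x ↦ f (x, 1)) = -logVariation (fun x ↦ f (x, 0)) := by
    rw [← logVariation_neg_symm (by fun_prop) bottom₀]
    congr with x
    simpa using (hodd (σ x) 0)
  have right : logVariation (fun y ↦ f (1, y)) = -logVariation (fun y ↦ f (0, y)) := by
    rw [← logVariation_neg_symm (by fun_prop) left₀]
    congr with y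
    simpa using (hodd 0 (σ y))
  intro hzero
  have hsides : logVariation (fun x ↦ f (x, 0)) = logVariation (fun y ↦ f (0, y)) := by
    rw [boundaryLogVariation, top, right] at hzero
    linear_combination hzero / 2
  have hcorners : f (1, 0) / f (0, 0) = f (0, 1) / f (0, 0) := by
    rw [← exp_logVariation (f := fun x ↦ f (x, 0)) (by fun_prop) bottom₀,
      ← exp_logVariation (f := fun y ↦ f (0, y)) (by fun_prop) left₀, hsides]
  have hopposite : f (1, 0) = -f (0, 1) := by simpa using hodd 0 1
  rw [div_left_inj' (bottom₀ 0), hopposite, neg_eq_self] at hcorners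
  exact left₀ 1 hcorners

theorem boundaryLogVariation_sub_eq_zero {a b c d : ℂ} {A A' : Path a c} {B B' : Path b d}
    (hAB' : Disjoint (Set.range A) (Set.range B'))
    (hA'B : Disjoint (Set.range A') (Set.range B))
    (hA'B' : Disjoint (Set.range A') (Set.range B')) :
    boundaryLogVariation (fun p ↦ A p.1 - B p.2) = 0 := by
  have vanish {P : Path a c} {Q : Path b d} (h : Disjoint (Set.range P) (Set.range Q)) :
      boundaryLogVariation (fun p ↦ P p.1 - Q p.2) = 0 :=
    boundaryLogVariation_eq_zero (by fun_prop) fun p ↦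
      sub_ne_zero.2 (h.ne_of_mem (Set.mem_range_self _) (Set.mem_range_self _))
  have hAB' := vanish hAB'
  have hA'B := vanish hA'B
  have hA'B' := vanish hA'B'
  simp only [boundaryLogVariation, Path.source, Path.target] at *
  linear_combination hAB' + hA'B - hA'B'

/-- The affine parametrisation of the diameter of the unit disc from `1` to `-1`. -/
noncomputable def diameter (x : I) : ℂ := ((1 - 2 * x : ℝ) : ℂ)

@[fun_prop]
theorem continuous_diameter : Continuous diameter := by unfold diameter; fun_prop

@[simp] theorem diameter_zero : diameter 0 = 1 := by simp [diameter]

@[simp] theorem diameter_one : diameter 1 = -1 := by norm_num [diameter]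

@[simp] theorem diameter_symm (x : I) : diameter (σ x) = -diameter x := by
  rw [diameter, diameter, unitInterval.coe_symm_eq, ← Complex.ofReal_neg]
  congr 1
  ring

theorem norm_diameter_le (x : I) : ‖diameter x‖ ≤ 1 := by
  rw [diameter, Complex.norm_real, Real.norm_eq_abs, abs_le]
  constructor <;> linarith [x.2.1, x.2.2]

theorem diameter_eq_I_mul_diameter_iff {x y : I} :
    diameter x = Complex.I * diameter y ↔ diameter x = 0 ∧ diameter y = 0 := by
  simp [diameter, Complex.ext_iff, -Complex.ofReal_sub, -Complex.ofReal_mul, eq_comm]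

theorem diameter_ne_I_mul_diameter {p : I × I} (hp : p ∈ squareBoundary) :
    diameter p.1 ≠ Complex.I * diameter p.2 := by
  rw [Ne, diameter_eq_I_mul_diameter_iff]
  rcases hp with h | h | h | h <;> simp [h]

/-- The point `s` translated towards `-(s + t) / 2`: moving both `s` and `t` in this way, for `k`
from `0` to `1`, deforms an arbitrary pair of points of the disc to an antipodal one and preserves
their difference. -/
noncomputable def recenter (k : I) (s t : ℂ) : ℂ := s - k * ((s + t) / 2)

theorem recenter_mem_closedBall (k : I) {s t : ℂ} (hs : ‖s‖ ≤ 1) (ht : ‖t‖ ≤ 1) :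
    recenter k s t ∈ Metric.closedBall (0 : ℂ) 1 := by
  have hcomb : recenter k s t = ((1 - k / 2 : ℝ) : ℂ) * s - ((k / 2 : ℝ) : ℂ) * t := by
    rw [recenter]; push_cast; ring
  rw [mem_closedBall_zero_iff, hcomb]
  refine (norm_sub_le _ _).trans ?_
  rw [norm_mul, norm_mul, Complex.norm_of_nonneg (by linarith [k.2.2]),
    Complex.norm_of_nonneg (by linarith [k.2.1])]
  nlinarith [k.2.1, k.2.2]

theorem recenter_sub_recenter (k : I) (s t : ℂ) : recenter k s t - recenter k t s = s - t := by
  rw [recenter, recenter]; ring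

theorem recenter_one_neg_neg (s t : ℂ) : recenter 1 (-s) (-t) = recenter 1 t s := by
  simp only [recenter, Set.Icc.coe_one, Complex.ofReal_one]; ring

theorem boundaryLogVariation_diameters_ne_zero {h : ℂ → ℂ}
    (hc : ContinuousOn h (Metric.closedBall 0 1)) (hi : Set.InjOn h (Metric.closedBall 0 1)) :
    boundaryLogVariation (fun p ↦ h (diameter p.1) - h (Complex.I * diameter p.2)) ≠ 0 := by
  let s (p : I × I) : ℂ := diameter p.1
  let t (p : I × I) : ℂ := Complex.I * diameter p.2
  have hs (p) : ‖s p‖ ≤ 1 := norm_diameter_le p.1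
  have ht (p) : ‖t p‖ ≤ 1 := by simpa [t] using norm_diameter_le p.2
  let H (k : I) (p : I × I) : ℂ := h (recenter k (s p) (t p)) - h (recenter k (t p) (s p))
  have hH : Continuous fun q : I × I × I ↦ H q.1 q.2 := by
    refine .sub (hc.comp_continuous ?_ fun q ↦ recenter_mem_closedBall q.1 (hs q.2) (ht q.2))
      (hc.comp_continuous ?_ fun q ↦ recenter_mem_closedBall q.1 (ht q.2) (hs q.2)) <;>
    · unfold recenter s t; fun_prop
  have hH₀ (k : I) (p) (hp : p ∈ squareBoundary) : H k p ≠ 0 := fun hzero ↦ by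
    have heq := hi (recenter_mem_closedBall k (hs p) (ht p))
      (recenter_mem_closedBall k (ht p) (hs p)) (sub_eq_zero.1 hzero)
    rw [← sub_eq_zero, recenter_sub_recenter, sub_eq_zero] at heq
    exact diameter_ne_I_mul_diameter hp heq
  have hodd (x y : I) : H 1 (σ x, σ y) = -H 1 (x, y) := by
    simp only [H, s, t, diameter_symm, mul_neg, recenter_one_neg_neg, neg_sub]
  have hstart : H 0 = fun p ↦ h (diameter p.1) - h (Complex.I * diameter p.2) := by
    simp [H, s, t, recenter]
  rw [← hstart, boundaryLogVariation_eq_of_homotopy hH hH₀]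
  exact boundaryLogVariation_ne_zero_of_odd (hH.comp (Continuous.prodMk_right 1)) (hH₀ 1) hodd

/-- Exchanging the diameters of the disc one by one for `A` and `B` does not change the winding
number, unless the paths of one of the intermediate pairs meet. -/
theorem not_disjoint_range_of_disc {h : ℂ → ℂ}
    (hc : ContinuousOn h (Metric.closedBall 0 1)) (hi : Set.InjOn h (Metric.closedBall 0 1))
    {A : Path (h 1) (h (-1))} {B : Path (h Complex.I) (h (-Complex.I))}
    (hA : ∀ z ∈ Metric.closedBall 0 1, h z ∈ Set.range A → z = 1 ∨ z = -1)
    (hB : ∀ z ∈ Metric.closedBall 0 1, h z ∈ Set.range B → z = Complex.I ∨ z = -Complex.I) :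
    ¬Disjoint (Set.range A) (Set.range B) := by
  intro hAB
  have hs (x : I) : diameter x ∈ Metric.closedBall (0 : ℂ) 1 := by simpa using norm_diameter_le x
  have ht (y : I) : Complex.I * diameter y ∈ Metric.closedBall (0 : ℂ) 1 := by
    simpa using norm_diameter_le y
  let A₀ : Path (h 1) (h (-1)) :=
    ⟨⟨fun x ↦ h (diameter x), hc.comp_continuous (by fun_prop) hs⟩, by simp, by simp⟩
  let B₀ : Path (h Complex.I) (h (-Complex.I)) :=
    ⟨⟨fun y ↦ h (Complex.I * diameter y), hc.comp_continuous (by fun_prop) ht⟩, by simp, by simp⟩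
  have hA₀B : Disjoint (Set.range A₀) (Set.range B) := by
    rw [Set.disjoint_left, Set.forall_mem_range]
    intro x hx
    simpa [diameter, Complex.ext_iff] using hB _ (hs x) hx
  have hAB₀ : Disjoint (Set.range A) (Set.range B₀) := by
    rw [Set.disjoint_right, Set.forall_mem_range]
    intro y hy
    simpa [diameter, Complex.ext_iff] using hA _ (ht y) hy
  exact boundaryLogVariation_diameters_ne_zero hc hi
    (boundaryLogVariation_sub_eq_zero (A := A₀) (B := B₀) hA₀B hAB₀ hAB)

end WindingNumber

namespace PlaneDrawing

variable {α : Type*} {G : SimpleGraph α} {D : PlaneDrawing G}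

/-- The set of points of the drawing that represents a walk. The vertices are listed separately,
since a walk of length `0` has no edges. -/
def walkSet (D : PlaneDrawing G) {u v : α} (p : G.Walk u v) : Set ℂ :=
  D.pos '' {w | w ∈ p.support} ∪ ⋃ e ∈ p.edges, D.arc e

theorem walkSet_subset_support {u v : α} (p : G.Walk u v) : D.walkSet p ⊆ D.support :=
  Set.union_subset_union (Set.image_subset_range _ _)
    (Set.biUnion_subset_biUnion_left fun _ he ↦ p.edges_subset_edgeSet he)

theorem walkSet_subset_walkSet_cons {u v w : α} (h : G.Adj u v) (p : G.Walk v w) :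
    D.walkSet p ⊆ D.walkSet (p.cons h) :=
  Set.union_subset_union (Set.image_mono fun _ hx ↦ List.mem_cons_of_mem _ hx)
    (Set.biUnion_subset_biUnion_left fun _ he ↦ List.mem_cons_of_mem _ he)

theorem arc_subset_walkSet_cons {u v w : α} (h : G.Adj u v) (p : G.Walk v w) :
    D.arc s(u, v) ⊆ D.walkSet (p.cons h) :=
  (Set.subset_biUnion_of_mem (u := D.arc) List.mem_cons_self).trans Set.subset_union_right

theorem exists_path_range_subset_walkSet {u v : α} (p : G.Walk u v) :
    ∃ γ : Path (D.pos u) (D.pos v), Set.range γ ⊆ D.walkSet p := by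
  induction p with
  | nil => exact ⟨Path.refl _, by simp [walkSet]⟩
  | cons h p ih =>
    obtain ⟨γ, hγ⟩ := ih
    obtain ⟨δ, -, hδ⟩ := D.isArc _ _ h
    refine ⟨δ.trans γ, ?_⟩
    rw [Path.trans_range, hδ]
    exact Set.union_subset (arc_subset_walkSet_cons h p)
      (hγ.trans (walkSet_subset_walkSet_cons h p))

theorem mem_support_of_pos_mem_walkSet {u v w : α} {p : G.Walk u v}
    (hw : D.pos w ∈ D.walkSet p) : w ∈ p.support := by
  rcases hw with ⟨z, hz, hzw⟩ | hw
  · rwa [← D.pos_injective hzw]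
  · obtain ⟨e, he, hwe⟩ := Set.mem_iUnion₂.1 hw
    exact p.mem_support_of_mem_edges he
      (D.mem_of_pos_mem_arc e (p.edges_subset_edgeSet he) w hwe)

theorem disjoint_walkSet {a b c d : α} {p : G.Walk a b} {q : G.Walk c d}
    (hpq : ∀ v ∈ p.support, v ∉ q.support) : Disjoint (D.walkSet p) (D.walkSet q) := by
  rw [Set.disjoint_left]
  intro z hzp hzq
  have hz (w : α) : D.pos w ≠ z := by
    rintro rfl
    exact hpq w (mem_support_of_pos_mem_walkSet hzp) (mem_support_of_pos_mem_walkSet hzq)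
  obtain ⟨e, he, hze⟩ := Set.mem_iUnion₂.1 (hzp.resolve_left fun ⟨w, _, hw⟩ ↦ hz w hw)
  obtain ⟨f, hf, hzf⟩ := Set.mem_iUnion₂.1 (hzq.resolve_left fun ⟨w, _, hw⟩ ↦ hz w hw)
  have hef : e ≠ f := by
    rintro rfl
    have hv := e.out_fst_mem
    exact hpq _ (p.mem_support_of_mem_edges he hv) (q.mem_support_of_mem_edges hf hv)
  obtain ⟨w, hw⟩ := D.arc_inter_arc_subset e (p.edges_subset_edgeSet he) f
    (q.edges_subset_edgeSet hf) hef ⟨hze, hzf⟩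
  exact hz w hw

theorem IsFace.disjoint_support {F : Set ℂ} (hF : D.IsFace F) : Disjoint F D.support := by
  obtain ⟨x, -, rfl⟩ := hF
  exact Set.disjoint_left.2 fun _ hz ↦ connectedComponentIn_subset _ _ hz

namespace CyclicOnFace

variable {F : Set ℂ} {a b c d : α}

theorem exists_mem_support_inter (hF : D.IsFace F) (hcyc : D.CyclicOnFace F a b c d)
    (p : G.Walk a c) (q : G.Walk b d) : ∃ v ∈ p.support, v ∈ q.support := by
  by_contra! hpq
  obtain ⟨h, hc, hi, ha, hb, hc', hd, hin⟩ := hcyc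
  obtain ⟨A, hA⟩ := exists_path_range_subset_walkSet (D := D) p
  obtain ⟨B, hB⟩ := exists_path_range_subset_walkSet (D := D) q
  have hcorner {z : ℂ} (hz : z ∈ Metric.closedBall 0 1) (hzD : h z ∈ D.support) :
      z ∈ ({1, Complex.I, -1, -Complex.I} : Set ℂ) := by
    by_contra hz'
    exact hF.disjoint_support.notMem_of_mem_left (hin z hz hz') hzD
  refine not_disjoint_range_of_disc hc hi (A := A.cast ha hc') (B := B.cast hb hd) ?_ ?_
    ((disjoint_walkSet hpq).mono hA hB)
  · intro z hz hzA
    have hzp : h z ∈ D.walkSet p := hA hzA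
    rcases hcorner hz (walkSet_subset_support p hzp) with rfl | rfl | rfl | rfl
    · exact .inl rfl
    · exact (hpq b (mem_support_of_pos_mem_walkSet (hb ▸ hzp)) q.start_mem_support).elim
    · exact .inr rfl
    · exact (hpq d (mem_support_of_pos_mem_walkSet (hd ▸ hzp)) q.end_mem_support).elim
  · intro z hz hzB
    have hzq : h z ∈ D.walkSet q := hB hzB
    rcases hcorner hz (walkSet_subset_support q hzq) with rfl | rfl | rfl | rfl
    · exact (hpq a p.start_mem_support (mem_support_of_pos_mem_walkSet (ha ▸ hzq))).elim
    · exact .inl rfl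
    · exact (hpq c p.end_mem_support (mem_support_of_pos_mem_walkSet (hc' ▸ hzq))).elim
    · exact .inr rfl

theorem nodup (hcyc : D.CyclicOnFace F a b c d) : [a, b, c, d].Nodup := by
  obtain ⟨h, -, hi, ha, hb, hc, hd, -⟩ := hcyc
  have hcorners : [1, Complex.I, -1, -Complex.I].Nodup := by
    norm_num [Complex.ext_iff]
  have himage : ([1, Complex.I, -1, -Complex.I].map h).Nodup :=
    hcorners.map_on fun x hx y hy ↦ hi (by aesop) (by aesop)
  rw [show [1, Complex.I, -1, -Complex.I].map h = [a, b, c, d].map D.pos by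
    simp [ha, hb, hc, hd]] at himage
  exact himage.of_map

end CyclicOnFace

end PlaneDrawing

section Superposition

open scoped symmDiff

variable {α : Type*} {G : SimpleGraph α} {H K : G.Subgraph} {P Q : Finset (Sym2 α)} {C : Set α}

/-- No edge of `P` joins `C` to its complement, so that `P` can be changed inside and outside `C`
independently. -/
def EdgeClosed (P : Finset (Sym2 α)) (C : Set α) : Prop :=
  ∀ e ∈ P, ∀ v ∈ e, v ∈ C → e ∈ C.sym2

open Classical in
/-- The edges of `P` outside `C` together with those of `Q` inside `C`. -/
noncomputable def swapOn (C : Set α) (P Q : Finset (Sym2 α)) : Finset (Sym2 α) :=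
  {e ∈ P | e ∉ C.sym2} ∪ {e ∈ Q | e ∈ C.sym2}

theorem mem_swapOn {e : Sym2 α} :
    e ∈ swapOn C P Q ↔ e ∈ P ∧ e ∉ C.sym2 ∨ e ∈ Q ∧ e ∈ C.sym2 := by
  simp only [swapOn, Finset.mem_union, Finset.mem_filter]

theorem coe_swapOn_union_coe_swapOn (C : Set α) (P Q : Finset (Sym2 α)) :
    (↑(swapOn C P Q) ∪ ↑(swapOn C Q P) : Set (Sym2 α)) = ↑P ∪ ↑Q := by
  ext e
  simp only [Set.mem_union, Finset.mem_coe, mem_swapOn]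
  tauto

theorem swapOn_swapOn (C : Set α) (P Q : Finset (Sym2 α)) :
    swapOn C (swapOn C P Q) (swapOn C Q P) = P := by
  ext e
  simp only [mem_swapOn]
  tauto

theorem prod_swapOn_mul_prod_swapOn {M : Type*} [CommMonoid M] (w : Sym2 α → M) (C : Set α)
    (P Q : Finset (Sym2 α)) :
    (∏ e ∈ swapOn C P Q, w e) * ∏ e ∈ swapOn C Q P, w e = (∏ e ∈ P, w e) * ∏ e ∈ Q, w e := by
  classical
  have hdisj (P Q : Finset (Sym2 α)) : Disjoint {e ∈ P | e ∉ C.sym2} {e ∈ Q | e ∈ C.sym2} :=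
    Finset.disjoint_filter_filter_not _ _ _ |>.symm
  rw [swapOn, swapOn, Finset.prod_union (hdisj P Q), Finset.prod_union (hdisj Q P),
    ← Finset.prod_filter_mul_prod_filter_not P (· ∈ C.sym2),
    ← Finset.prod_filter_mul_prod_filter_not Q (· ∈ C.sym2)]
  ac_rfl

/-- The superposition of two matchings: the graph whose edges are those of `P` and of `Q`, a common
edge being taken once. -/
def superposition (P Q : Finset (Sym2 α)) : SimpleGraph α :=
  SimpleGraph.fromEdgeSet (↑P ∪ ↑Q)

theorem edgeSet_superposition_subset (P Q : Finset (Sym2 α)) :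
    (superposition P Q).edgeSet ⊆ ↑P ∪ ↑Q := by
  rw [superposition, SimpleGraph.edgeSet_fromEdgeSet]
  exact Set.sdiff_subset

theorem superposition_comm (P Q : Finset (Sym2 α)) : superposition P Q = superposition Q P := by
  rw [superposition, superposition, Set.union_comm]

theorem superposition_swapOn (C : Set α) (P Q : Finset (Sym2 α)) :
    superposition (swapOn C P Q) (swapOn C Q P) = superposition P Q := by
  rw [superposition, superposition, coe_swapOn_union_coe_swapOn]

theorem ncard_supp_le_ncard_edgeSet_add_one [Finite α] (c : G.ConnectedComponent) :
    c.supp.ncard ≤ (G.edgeSet ∩ c.supp.sym2).ncard + 1 := by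
  have hmaps (e : c.toSimpleGraph.edgeSet) :
      Sym2.map Subtype.val e.1 ∈ G.edgeSet ∩ c.supp.sym2 := by
    obtain ⟨⟨u, v⟩, huv⟩ := e
    exact ⟨huv, u.2, v.2⟩
  have hinj : Function.Injective fun e : c.toSimpleGraph.edgeSet ↦
      (⟨_, hmaps e⟩ : (G.edgeSet ∩ c.supp.sym2 : Set (Sym2 α))) := fun e f hef ↦
    Subtype.ext (Sym2.map.injective Subtype.val_injective (congrArg Subtype.val hef))
  exact c.connected_toSimpleGraph.card_vert_le_card_edgeSet_add_one.trans
    (Nat.add_le_add_right (Nat.card_le_card_of_injective _ hinj) 1)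

namespace IsPerfectMatchingSet

theorem mem_verts (hP : IsPerfectMatchingSet H P) {e : Sym2 α} (he : e ∈ P) {v : α}
    (hv : v ∈ e) : v ∈ H.verts :=
  SimpleGraph.Subgraph.mem_verts_of_mem_edge (hP.subset_edgeSet e he) hv

theorem superposition_le (hP : IsPerfectMatchingSet H P) (hQ : IsPerfectMatchingSet K Q) :
    superposition P Q ≤ G := by
  rintro u v ⟨he | he, -⟩
  exacts [(hP.subset_edgeSet _ he).adj_sub, (hQ.subset_edgeSet _ he).adj_sub]

theorem edgeClosed_supp (hP : IsPerfectMatchingSet H P) {S : SimpleGraph α}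
    (hS : SimpleGraph.fromEdgeSet P ≤ S) (c : S.ConnectedComponent) : EdgeClosed P c.supp := by
  rintro ⟨u, v⟩ he x hx hxc
  have huv : u ∈ c.supp ↔ v ∈ c.supp :=
    c.mem_supp_congr_adj (hS ⟨he, (hP.subset_edgeSet _ he).adj_sub.ne⟩)
  rcases Sym2.mem_iff.1 hx with rfl | rfl
  exacts [⟨hxc, huv.1 hxc⟩, ⟨huv.2 hxc, hxc⟩]

theorem edgeClosed_left (hP : IsPerfectMatchingSet H P)
    (c : (superposition P Q).ConnectedComponent) : EdgeClosed P c.supp :=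
  hP.edgeClosed_supp (SimpleGraph.fromEdgeSet_mono Set.subset_union_left) c

theorem edgeClosed_right (hQ : IsPerfectMatchingSet K Q)
    (c : (superposition P Q).ConnectedComponent) : EdgeClosed Q c.supp :=
  hQ.edgeClosed_supp (SimpleGraph.fromEdgeSet_mono Set.subset_union_right) c

theorem swapOn {L : G.Subgraph} (hP : IsPerfectMatchingSet H P) (hQ : IsPerfectMatchingSet K Q)
    (hPC : EdgeClosed P C) (hQC : EdgeClosed Q C) (hL : L.IsInduced)
    (hverts : L.verts = H.verts \ C ∪ K.verts ∩ C) :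
    IsPerfectMatchingSet L (swapOn C P Q) where
  subset_edgeSet := by
    rintro ⟨u, v⟩ he
    have hu : u ∈ s(u, v) := by simp
    have hv : v ∈ s(u, v) := by simp
    rcases mem_swapOn.1 he with ⟨he, heC⟩ | ⟨he, heC⟩
    · exact hL (hverts ▸ .inl ⟨hP.mem_verts he hu, fun h ↦ heC (hPC _ he u hu h)⟩)
        (hverts ▸ .inl ⟨hP.mem_verts he hv, fun h ↦ heC (hPC _ he v hv h)⟩)
        (hP.subset_edgeSet _ he).adj_sub
    · exact hL (hverts ▸ .inr ⟨hQ.mem_verts he hu, heC.1⟩)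
        (hverts ▸ .inr ⟨hQ.mem_verts he hv, heC.2⟩) (hQ.subset_edgeSet _ he).adj_sub
  independent := by
    intro e he f hf hef v hve hvf
    rcases mem_swapOn.1 he with ⟨he, heC⟩ | ⟨he, heC⟩ <;>
      rcases mem_swapOn.1 hf with ⟨hf, hfC⟩ | ⟨hf, hfC⟩
    · exact hP.independent e he f hf hef v hve hvf
    · exact heC (hPC e he v hve (Set.mem_sym2_iff_subset.1 hfC hvf))
    · exact hfC (hPC f hf v hvf (Set.mem_sym2_iff_subset.1 heC hve))
    · exact hQ.independent e he f hf hef v hve hvf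
  covers := by
    intro v hv
    rcases hverts ▸ hv with ⟨hvH, hvC⟩ | ⟨hvK, hvC⟩
    · obtain ⟨e, he, hve⟩ := hP.covers v hvH
      exact ⟨e, mem_swapOn.2 (.inl ⟨he, fun h ↦ hvC (Set.mem_sym2_iff_subset.1 h hve)⟩), hve⟩
    · obtain ⟨e, he, hve⟩ := hQ.covers v hvK
      exact ⟨e, mem_swapOn.2 (.inr ⟨he, hQC e he v hve hvC⟩), hve⟩

theorem ncard_inter_verts [Finite α] (hP : IsPerfectMatchingSet H P) (A : Set α) :
    (A ∩ H.verts).ncard = ∑ e ∈ P, (A ∩ e : Set α).ncard := by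
  have hunion : A ∩ H.verts = ⋃ e ∈ (P : Set (Sym2 α)), A ∩ e := by
    ext v
    simp only [Set.mem_iUnion, Set.mem_inter_iff, SetLike.mem_coe]
    constructor
    · rintro ⟨hvA, hvH⟩
      obtain ⟨e, he, hve⟩ := hP.covers v hvH
      exact ⟨e, he, hvA, hve⟩
    · rintro ⟨e, he, hvA, hve⟩
      exact ⟨hvA, hP.mem_verts he hve⟩
  have hdisj : (P : Set (Sym2 α)).PairwiseDisjoint fun e ↦ A ∩ (e : Set α) :=
    fun e he f hf hef ↦ Set.disjoint_left.2 fun v hve hvf ↦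
      hP.independent e he f hf hef v hve.2 hvf.2
  rw [hunion, P.finite_toSet.ncard_biUnion (fun _ _ ↦ Set.toFinite _) hdisj,
    finsum_mem_coe_finset]

theorem ncard_inter_verts_of_edgeClosed [Finite α] (hP : IsPerfectMatchingSet H P)
    (hC : EdgeClosed P C) : (C ∩ H.verts).ncard = 2 * ((P : Set (Sym2 α)) ∩ C.sym2).ncard := by
  classical
  have hedge (e) (he : e ∈ P) : (C ∩ e : Set α).ncard = if e ∈ C.sym2 then 2 else 0 := by
    split_ifs with heC
    · rw [Set.inter_eq_self_of_subset_right (Set.mem_sym2_iff_subset.1 heC)]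
      induction e with
      | _ u v => rw [Sym2.coe_mk, Set.ncard_pair (hP.subset_edgeSet _ he).adj_sub.ne]
    · rw [Set.ncard_eq_zero, Set.eq_empty_iff_forall_notMem]
      exact fun v hv ↦ heC (hC e he v hv.2 hv.1)
  rw [hP.ncard_inter_verts, Finset.sum_congr rfl hedge, ← Finset.sum_filter, Finset.sum_const,
    smul_eq_mul, mul_comm, ← Set.ncard_coe_finset, Finset.coe_filter]
  rfl

end IsPerfectMatchingSet

/-- The vertices of the component of `a` in the superposition of `P` and `Q` that belong to exactly
one of `H` and `K`. If `P` and `Q` are perfect matchings of `H` and `K` and `a` is one of these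
vertices, then the component is a path, and these vertices are its ends. -/
def pathEnds (H K : G.Subgraph) (P Q : Finset (Sym2 α)) (a : α) : Set α :=
  (H.verts ∆ K.verts) ∩ ((superposition P Q).connectedComponentMk a).supp

theorem mem_pathEnds {a v : α} : v ∈ pathEnds H K P Q a ↔
    v ∈ H.verts ∆ K.verts ∧ (superposition P Q).Reachable v a := by
  rw [pathEnds, Set.mem_inter_iff, SimpleGraph.ConnectedComponent.mem_supp_iff,
    SimpleGraph.ConnectedComponent.eq]

theorem pathEnds_comm (H K : G.Subgraph) (P Q : Finset (Sym2 α)) (a : α) :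
    pathEnds H K P Q a = pathEnds K H Q P a := by
  rw [pathEnds, pathEnds, symmDiff_comm, superposition_comm]

theorem mem_pathEnds_self {a : α} : a ∈ pathEnds H K P Q a ↔ a ∈ H.verts ∆ K.verts :=
  mem_pathEnds.trans (and_iff_left .rfl)

/-- Inside the component, `P` matches the vertices of `H` in pairs and `Q` those of `K`. Since a
connected graph has at most one vertex more than it has edges, at most two vertices are missed by
`P` or by `Q`, and their number is even. -/
theorem ncard_pathEnds [Finite α] (hP : IsPerfectMatchingSet H P)
    (hQ : IsPerfectMatchingSet K Q) {a : α} (ha : a ∈ H.verts ∆ K.verts) :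
    (pathEnds H K P Q a).ncard = 2 := by
  let c := (superposition P Q).connectedComponentMk a
  have hH : (c.supp ∩ H.verts).ncard = 2 * ((P : Set (Sym2 α)) ∩ c.supp.sym2).ncard :=
    hP.ncard_inter_verts_of_edgeClosed (hP.edgeClosed_left c)
  have hK : (c.supp ∩ K.verts).ncard = 2 * ((Q : Set (Sym2 α)) ∩ c.supp.sym2).ncard :=
    hQ.ncard_inter_verts_of_edgeClosed (hQ.edgeClosed_right c)
  have hedges : ((superposition P Q).edgeSet ∩ c.supp.sym2).ncard ≤
      ((P : Set (Sym2 α)) ∩ c.supp.sym2).ncard + ((Q : Set (Sym2 α)) ∩ c.supp.sym2).ncard := by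
    refine (Set.ncard_le_ncard ?_).trans (Set.ncard_union_le _ _)
    rw [← Set.union_inter_distrib_right]
    exact Set.inter_subset_inter_left _ (edgeSet_superposition_subset P Q)
  have hends : pathEnds H K P Q a = (c.supp ∩ H.verts) ∆ (c.supp ∩ K.verts) := by
    rw [pathEnds, Set.inter_comm, Set.inter_symmDiff_distrib_left]
  have hsymmDiff : (pathEnds H K P Q a).ncard + (c.supp ∩ H.verts ∩ (c.supp ∩ K.verts)).ncard =
      (c.supp ∩ H.verts ∪ c.supp ∩ K.verts).ncard := by
    rw [hends, symmDiff_eq_sup_sdiff_inf]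
    exact Set.ncard_sdiff_add_ncard_of_subset (Set.inter_subset_left.trans Set.subset_union_left)
  have hinclexcl := Set.ncard_union_add_ncard_inter (c.supp ∩ H.verts) (c.supp ∩ K.verts)
  have hverts : (c.supp ∩ H.verts ∪ c.supp ∩ K.verts).ncard ≤ c.supp.ncard :=
    Set.ncard_le_ncard (Set.union_subset Set.inter_subset_left Set.inter_subset_left)
  have hpos : 0 < (pathEnds H K P Q a).ncard := (Set.ncard_pos).2 ⟨a, mem_pathEnds_self.2 ha⟩
  have htree := ncard_supp_le_ncard_edgeSet_add_one c
  omega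

theorem exists_pathEnds_eq_pair [Finite α] (hP : IsPerfectMatchingSet H P)
    (hQ : IsPerfectMatchingSet K Q) {a : α} (ha : a ∈ H.verts ∆ K.verts) :
    ∃ x ≠ a, pathEnds H K P Q a = {a, x} := by
  obtain ⟨x, y, hxy, h⟩ := Set.ncard_eq_two.1 (ncard_pathEnds hP hQ ha)
  rcases h ▸ mem_pathEnds_self.2 ha with rfl | rfl
  exacts [⟨y, hxy.symm, h⟩, ⟨x, hxy, h.trans (Set.pair_comm _ _)⟩]

theorem pathEnds_eq_or_eq [Finite α] (hP : IsPerfectMatchingSet H P)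
    (hQ : IsPerfectMatchingSet K Q) {a b c d : α} (hnodup : [a, b, c, d].Nodup)
    (hcross : ∀ (p : G.Walk a c) (q : G.Walk b d), ∃ v ∈ p.support, v ∈ q.support)
    (hverts : H.verts ∆ K.verts = {a, b, c, d}) :
    pathEnds H K P Q a = {a, b} ∨ pathEnds H K P Q a = {a, d} := by
  classical
  obtain ⟨x, hxa, hx⟩ := exists_pathEnds_eq_pair hP hQ (a := a) (by simp [hverts])
  obtain ⟨y, hyb, hy⟩ := exists_pathEnds_eq_pair hP hQ (a := b) (by simp [hverts])
  obtain ⟨hxT, hxR⟩ := mem_pathEnds.1 (show x ∈ pathEnds H K P Q a by simp [hx])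
  obtain ⟨hyT, hyR⟩ := mem_pathEnds.1 (show y ∈ pathEnds H K P Q b by simp [hy])
  rcases hverts ▸ hxT with rfl | rfl | rfl | rfl
  · exact absurd rfl hxa
  · exact .inl hx
  · have hba : ¬(superposition P Q).Reachable b a := fun h ↦ by
      have hb : b ∈ pathEnds H K P Q a := mem_pathEnds.2 ⟨by simp [hverts], h⟩
      rw [hx] at hb
      grind
    exfalso
    rcases hverts ▸ hyT with rfl | rfl | rfl | rfl
    · exact hba hyR.symm
    · exact hyb rfl
    · exact hba (hyR.symm.trans hxR)
    · obtain ⟨p⟩ := hxR.symm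
      obtain ⟨q⟩ := hyR.symm
      have hle := hP.superposition_le hQ
      obtain ⟨v, hvp, hvq⟩ := hcross (p.mapLe hle) (q.mapLe hle)
      rw [SimpleGraph.Walk.support_mapLe_eq_support] at hvp hvq
      exact hba ((q.takeUntil v hvq).reachable.trans (p.takeUntil v hvp).reachable.symm)
  · exact .inr hx

/-- The edges of `P` with those in the component of `a` in the superposition of `P` and `Q` replaced
by the edges of `Q` in that component. -/
noncomputable def exchange (a : α) (P Q : Finset (Sym2 α)) : Finset (Sym2 α) :=
  swapOn ((superposition P Q).connectedComponentMk a).supp P Q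

theorem superposition_exchange (a : α) (P Q : Finset (Sym2 α)) :
    superposition (exchange a P Q) (exchange a Q P) = superposition P Q := by
  rw [exchange, exchange, superposition_comm Q P, superposition_swapOn]

theorem exchange_exchange (a : α) (P Q : Finset (Sym2 α)) :
    exchange a (exchange a P Q) (exchange a Q P) = P := by
  rw [exchange, superposition_exchange, exchange, exchange, superposition_comm Q P, swapOn_swapOn]

theorem prod_exchange_mul_prod_exchange {M : Type*} [CommMonoid M] (w : Sym2 α → M) (a : α)
    (P Q : Finset (Sym2 α)) :
    (∏ e ∈ exchange a P Q, w e) * ∏ e ∈ exchange a Q P, w e =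
      (∏ e ∈ P, w e) * ∏ e ∈ Q, w e := by
  rw [exchange, exchange, superposition_comm Q P, prod_swapOn_mul_prod_swapOn]

theorem IsPerfectMatchingSet.exchange (hP : IsPerfectMatchingSet H P)
    (hQ : IsPerfectMatchingSet K Q) {a : α} {L : G.Subgraph} (hL : L.IsInduced)
    (hverts : L.verts = H.verts ∆ pathEnds H K P Q a) :
    IsPerfectMatchingSet L (exchange a P Q) := by
  refine hP.swapOn hQ (hP.edgeClosed_left _) (hQ.edgeClosed_right _) hL (hverts.trans ?_)
  ext v
  simp only [pathEnds, Set.mem_symmDiff, Set.mem_inter_iff, Set.mem_union, Set.mem_sdiff]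
  tauto

theorem pathEnds_exchange {H' K' : G.Subgraph}
    (hverts : H'.verts ∆ K'.verts = H.verts ∆ K.verts) (a : α) (P Q : Finset (Sym2 α)) :
    pathEnds H' K' (exchange a P Q) (exchange a Q P) a = pathEnds H K P Q a := by
  rw [pathEnds, superposition_exchange, hverts, pathEnds]

open Classical in
/-- The sum of the weights of the pairs of perfect matchings of `H` and `K` in whose superposition
the path through `a` has the set `S` of ends. -/
noncomputable def superpositionSum [Fintype α] {R : Type*} [CommRing R] (w : Sym2 α → R)
    (H K : G.Subgraph) (a : α) (S : Set α) : R :=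
  ∑ p : Finset (Sym2 α) × Finset (Sym2 α) with
      (IsPerfectMatchingSet H p.1 ∧ IsPerfectMatchingSet K p.2) ∧ pathEnds H K p.1 p.2 a = S,
    (∏ e ∈ p.1, w e) * ∏ e ∈ p.2, w e

theorem isInduced_deleteVerts (X : Set α) : ((⊤ : G.Subgraph).deleteVerts X).IsInduced :=
  fun _ hu _ hv huv ↦ SimpleGraph.Subgraph.deleteVerts_adj.2 ⟨hu.1, hu.2, hv.1, hv.2, huv⟩

variable [Fintype α] {R : Type*} [CommRing R] (w : Sym2 α → R)

theorem superpositionSum_comm (H K : G.Subgraph) (a : α) (S : Set α) :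
    superpositionSum w H K a S = superpositionSum w K H a S :=
  Finset.sum_equiv (Equiv.prodComm _ _)
    (fun p ↦ by simp [pathEnds_comm H K, and_comm]) fun p _ ↦ mul_comm _ _

theorem matchingSum_mul_matchingSum {a b c d : α} (hnodup : [a, b, c, d].Nodup)
    (hcross : ∀ (p : G.Walk a c) (q : G.Walk b d), ∃ v ∈ p.support, v ∈ q.support)
    (hverts : H.verts ∆ K.verts = {a, b, c, d}) :
    matchingSum w H * matchingSum w K =
      superpositionSum w H K a {a, b} + superpositionSum w H K a {a, d} := by
  classical
  have hne : ({a, b} : Set α) ≠ {a, d} := fun h ↦ by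
    have hb : b ∈ ({a, d} : Set α) := by simp [← h]
    grind
  rw [matchingSum, matchingSum, Finset.sum_mul_sum, ← Finset.sum_product', superpositionSum,
    superpositionSum, ← Finset.sum_union]
  · congr 1
    ext p
    simp only [Finset.mem_product, Finset.mem_filter_univ, Finset.mem_union, ← and_or_left]
    exact (and_iff_left_of_imp fun h ↦ pathEnds_eq_or_eq h.1 h.2 hnodup hcross hverts).symm
  · exact Finset.disjoint_filter.2 fun p _ hp hp' ↦ hne (hp.2.symm.trans hp'.2)

theorem superpositionSum_eq_of_symmDiff {H' K' : G.Subgraph} (hH : H.IsInduced) (hK : K.IsInduced)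
    (hH' : H'.IsInduced) (hK' : K'.IsInduced) {S : Set α} (hHS : H'.verts = H.verts ∆ S)
    (hKS : K'.verts = K.verts ∆ S) (a : α) :
    superpositionSum w H K a S = superpositionSum w H' K' a S := by
  have exchange_mem {H K H' K' : G.Subgraph} (hH' : H'.IsInduced) (hK' : K'.IsInduced)
      (hHS : H'.verts = H.verts ∆ S) (hKS : K'.verts = K.verts ∆ S) (P Q : Finset (Sym2 α))
      (h : (IsPerfectMatchingSet H P ∧ IsPerfectMatchingSet K Q) ∧ pathEnds H K P Q a = S) :
      (IsPerfectMatchingSet H' (exchange a P Q) ∧ IsPerfectMatchingSet K' (exchange a Q P)) ∧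
        pathEnds H' K' (exchange a P Q) (exchange a Q P) a = S := by
    obtain ⟨⟨hP, hQ⟩, rfl⟩ := h
    refine ⟨⟨hP.exchange hQ hH' hHS, hQ.exchange hP hK' (pathEnds_comm H K P Q a ▸ hKS)⟩, ?_⟩
    refine pathEnds_exchange ?_ a P Q
    rw [hHS, hKS, symmDiff_symmDiff_symmDiff_comm, symmDiff_self, symmDiff_bot]
  have hHS' : H.verts = H'.verts ∆ S := by rw [hHS, symmDiff_symmDiff_cancel_right]
  have hKS' : K.verts = K'.verts ∆ S := by rw [hKS, symmDiff_symmDiff_cancel_right]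
  refine Finset.sum_nbij' (fun p ↦ (exchange a p.1 p.2, exchange a p.2 p.1))
    (fun p ↦ (exchange a p.1 p.2, exchange a p.2 p.1)) ?_ ?_ ?_ ?_ ?_
  · simpa using exchange_mem hH' hK' hHS hKS
  · simpa using exchange_mem hH hK hHS' hKS'
  · exact fun p _ ↦ Prod.ext (exchange_exchange a _ _) (exchange_exchange a _ _)
  · exact fun p _ ↦ Prod.ext (exchange_exchange a _ _) (exchange_exchange a _ _)
  · exact fun p _ ↦ (prod_exchange_mul_prod_exchange w a _ _).symm

/-- Each of the four products splits into two superposition sums, and the eight sums agree in pairs: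
exchanging along the path from `a` moves its ends between the two deleted sets. -/
theorem matchingSum_condensation {a b c d : α} (hnodup : [a, b, c, d].Nodup)
    (hcross : ∀ (p : G.Walk a c) (q : G.Walk b d), ∃ v ∈ p.support, v ∈ q.support) :
    matchingSum w (⊤ : G.Subgraph) * matchingSum w ((⊤ : G.Subgraph).deleteVerts {a, b, c, d}) +
        matchingSum w ((⊤ : G.Subgraph).deleteVerts {a, c}) *
          matchingSum w ((⊤ : G.Subgraph).deleteVerts {b, d}) =
      matchingSum w ((⊤ : G.Subgraph).deleteVerts {a, b}) *
          matchingSum w ((⊤ : G.Subgraph).deleteVerts {c, d}) +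
        matchingSum w ((⊤ : G.Subgraph).deleteVerts {a, d}) *
          matchingSum w ((⊤ : G.Subgraph).deleteVerts {b, c}) := by
  let D (X : Set α) := (⊤ : G.Subgraph).deleteVerts X
  have expand (X Y : Set α) (hXY : (D X).verts ∆ (D Y).verts = {a, b, c, d}) :
      matchingSum w (D X) * matchingSum w (D Y) =
        superpositionSum w (D X) (D Y) a {a, b} + superpositionSum w (D X) (D Y) a {a, d} :=
    matchingSum_mul_matchingSum w hnodup hcross hXY
  have transfer (X Y X' Y' S : Set α) (hX : (D X').verts = (D X).verts ∆ S)
      (hY : (D Y').verts = (D Y).verts ∆ S) :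
      superpositionSum w (D X) (D Y) a S = superpositionSum w (D X') (D Y') a S :=
    superpositionSum_eq_of_symmDiff w (isInduced_deleteVerts X) (isInduced_deleteVerts Y)
      (isInduced_deleteVerts X') (isInduced_deleteVerts Y') hX hY a
  have htop : matchingSum w (⊤ : G.Subgraph) = matchingSum w (D ∅) :=
    congrArg (matchingSum w) SimpleGraph.Subgraph.deleteVerts_empty.symm
  rw [htop, expand ∅ {a, b, c, d}, expand {a, c} {b, d}, expand {a, b} {c, d}, expand {a, d} {b, c},
    transfer ∅ {a, b, c, d} {a, b} {c, d} {a, b}, transfer ∅ {a, b, c, d} {a, d} {b, c} {a, d},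
    transfer {a, c} {b, d} {b, c} {a, d} {a, b}, transfer {a, c} {b, d} {c, d} {a, b} {a, d},
    superpositionSum_comm w (D {b, c}), superpositionSum_comm w (D {c, d})]
  · ring
  all_goals
    ext v
    simp only [D, SimpleGraph.Subgraph.deleteVerts_verts, SimpleGraph.Subgraph.verts_top,
      Set.mem_symmDiff, Set.mem_sdiff, Set.mem_univ, Set.mem_insert_iff, Set.mem_singleton_iff,
      Set.mem_empty_iff_false]
    grind

end Superposition

section EdgeExpansion

variable {α : Type*} {G : SimpleGraph α} {H : G.Subgraph} {a b : α} {P : Finset (Sym2 α)}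

theorem isPerfectMatchingSet_deleteEdges_singleton_iff {e : Sym2 α} :
    IsPerfectMatchingSet (H.deleteEdges {e}) P ↔ IsPerfectMatchingSet H P ∧ e ∉ P := by
  have hedge (f : Sym2 α) : f ∈ (H.deleteEdges {e}).edgeSet ↔ f ∈ H.edgeSet ∧ f ≠ e := by
    induction f with
    | _ u v => simp
  constructor
  · rintro ⟨hsub, hind, hcov⟩
    exact ⟨⟨fun f hf ↦ ((hedge f).1 (hsub f hf)).1, hind, hcov⟩,
      fun he ↦ ((hedge e).1 (hsub e he)).2 rfl⟩
  · rintro ⟨⟨hsub, hind, hcov⟩, he⟩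
    exact ⟨fun f hf ↦ (hedge f).2 ⟨hsub f hf, ne_of_mem_of_not_mem hf he⟩, hind, hcov⟩

theorem mem_edgeSet_deleteVerts_pair {e : Sym2 α} :
    e ∈ (H.deleteVerts {a, b}).edgeSet ↔ e ∈ H.edgeSet ∧ a ∉ e ∧ b ∉ e := by
  induction e with
  | _ u v =>
    simp only [SimpleGraph.Subgraph.mem_edgeSet, SimpleGraph.Subgraph.deleteVerts_adj,
      Set.mem_insert_iff, Set.mem_singleton_iff, Sym2.mem_iff]
    constructor
    · rintro ⟨-, hu, -, hv, huv⟩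
      exact ⟨huv, by tauto, by tauto⟩
    · rintro ⟨huv, ha, hb⟩
      exact ⟨huv.fst_mem, by tauto, huv.snd_mem, by tauto, huv⟩

namespace IsPerfectMatchingSet

theorem erase [DecidableEq α] (hP : IsPerfectMatchingSet H P) (hab : s(a, b) ∈ P) :
    IsPerfectMatchingSet (H.deleteVerts {a, b}) (P.erase s(a, b)) where
  subset_edgeSet f hf := by
    obtain ⟨hne, hfP⟩ := Finset.mem_erase.1 hf
    have hdisj := hP.independent _ hab f hfP hne.symm
    exact mem_edgeSet_deleteVerts_pair.2 ⟨hP.subset_edgeSet f hfP,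
      hdisj a (Sym2.mem_mk_left a b), hdisj b (Sym2.mem_mk_right a b)⟩
  independent e he f hf :=
    hP.independent e (Finset.mem_of_mem_erase he) f (Finset.mem_of_mem_erase hf)
  covers := by
    rintro v ⟨hvH, hv⟩
    obtain ⟨f, hf, hvf⟩ := hP.covers v hvH
    refine ⟨f, Finset.mem_erase.2 ⟨?_, hf⟩, hvf⟩
    rintro rfl
    exact hv (Sym2.mem_iff.1 hvf)

theorem mk_notMem_of_deleteVerts (hP : IsPerfectMatchingSet (H.deleteVerts {a, b}) P) :
    s(a, b) ∉ P := fun h ↦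
  (mem_edgeSet_deleteVerts_pair.1 (hP.subset_edgeSet _ h)).2.1 (Sym2.mem_mk_left a b)

theorem insert [DecidableEq α] (hP : IsPerfectMatchingSet (H.deleteVerts {a, b}) P)
    (hab : H.Adj a b) : IsPerfectMatchingSet H (insert s(a, b) P) := by
  have hdisj (f) (hf : f ∈ P) (v) (hv : v ∈ s(a, b)) : v ∉ f := by
    obtain ⟨-, ha, hb⟩ := mem_edgeSet_deleteVerts_pair.1 (hP.subset_edgeSet f hf)
    rcases Sym2.mem_iff.1 hv with rfl | rfl
    exacts [ha, hb]
  refine ⟨fun f hf ↦ ?_, fun e he f hf hne v hve hvf ↦ ?_, fun v hv ↦ ?_⟩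
  · rcases Finset.mem_insert.1 hf with rfl | hf
    exacts [hab, (mem_edgeSet_deleteVerts_pair.1 (hP.subset_edgeSet f hf)).1]
  · rcases Finset.mem_insert.1 he with rfl | he <;> rcases Finset.mem_insert.1 hf with rfl | hf
    exacts [hne rfl, hdisj f hf v hve hvf, hdisj e he v hvf hve,
      hP.independent e he f hf hne v hve hvf]
  · by_cases hvab : v ∈ s(a, b)
    · exact ⟨_, Finset.mem_insert_self _ _, hvab⟩
    · obtain ⟨f, hf, hvf⟩ := hP.covers v ⟨hv, fun h ↦ hvab (Sym2.mem_iff.2 h)⟩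
      exact ⟨f, Finset.mem_insert_of_mem hf, hvf⟩

end IsPerfectMatchingSet

theorem matchingSum_eq_deleteEdges_add_deleteVerts [Fintype α] {R : Type*} [CommRing R]
    (w : Sym2 α → R) (hab : H.Adj a b) :
    matchingSum w H = matchingSum w (H.deleteEdges {s(a, b)}) +
      w s(a, b) * matchingSum w (H.deleteVerts {a, b}) := by
  classical
  simp only [matchingSum]
  rw [← Finset.sum_filter_not_add_sum_filter _ (s(a, b) ∈ ·)]
  congr 1
  · simp only [Finset.filter_filter, isPerfectMatchingSet_deleteEdges_singleton_iff]
  · rw [Finset.mul_sum, Finset.filter_filter]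
    refine Finset.sum_nbij' (Finset.erase · s(a, b)) (insert s(a, b) ·) ?_ ?_ ?_ ?_ ?_
    all_goals intro P hP; simp only [Finset.mem_filter_univ] at hP ⊢
    · exact hP.1.erase hP.2
    · exact ⟨hP.insert hab, Finset.mem_insert_self _ _⟩
    · exact Finset.insert_erase hP.2
    · exact Finset.erase_insert hP.mk_notMem_of_deleteVerts
    · exact (Finset.mul_prod_erase _ _ hP.2).symm

end EdgeExpansion

section Bipartite

variable {α : Type*} {G : SimpleGraph α} {H : G.Subgraph} {P : Finset (Sym2 α)}

theorem IsPerfectMatchingSet.ncard_inter_verts_eq_card [Finite α] {U V : Set α}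
    (hP : IsPerfectMatchingSet H P) (hG : G.IsBipartiteWith U V) :
    (U ∩ H.verts).ncard = P.card := by
  have hedge (e) (he : e ∈ P) : (U ∩ e : Set α).ncard = 1 := by
    induction e with
    | _ u v =>
      have hdisj := Set.disjoint_left.1 hG.disjoint
      rw [Set.ncard_eq_one]
      rcases hG.mem_of_adj (hP.subset_edgeSet _ he).adj_sub with ⟨hu, hv⟩ | ⟨hu, hv⟩
      · exact ⟨u, by grind [Sym2.coe_mk]⟩
      · exact ⟨v, by grind [Sym2.coe_mk]⟩
  rw [hP.ncard_inter_verts, Finset.sum_congr rfl hedge, Finset.card_eq_sum_ones]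

theorem matchingSum_eq_zero_of_ncard_ne [Fintype α] {R : Type*} [CommRing R] (w : Sym2 α → R)
    {U V : Set α} (hG : G.IsBipartiteWith U V)
    (hne : (U ∩ H.verts).ncard ≠ (V ∩ H.verts).ncard) : matchingSum w H = 0 := by
  classical
  refine Finset.sum_eq_zero fun P hP ↦ ?_
  obtain hP : IsPerfectMatchingSet H P := by simpa using hP
  exact absurd ((hP.ncard_inter_verts_eq_card hG).trans
    (hP.ncard_inter_verts_eq_card hG.symm).symm) hne

theorem matchingSum_deleteVerts_pair_eq_zero [Fintype α] {R : Type*} [CommRing R]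
    (w : Sym2 α → R) {U V : Finset α} (hG : G.IsBipartiteWith (U : Set α) (V : Set α))
    (hcard : U.card = V.card) {x y : α} (hxy : x ∈ U ∧ y ∈ U ∨ x ∈ V ∧ y ∈ V) :
    matchingSum w ((⊤ : G.Subgraph).deleteVerts {x, y}) = 0 := by
  wlog hU : x ∈ U ∧ y ∈ U generalizing U V
  · exact this hG.symm hcard.symm hxy.symm (hxy.resolve_left hU)
  have hVxy : (V : Set α) ∩ {x, y}ᶜ = V := by
    have hV := Set.disjoint_left.1 hG.disjoint
    refine Set.inter_eq_left.2 fun v hvV ↦ ?_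
    rintro (rfl | rfl)
    exacts [hV hU.1 hvV, hV hU.2 hvV]
  refine matchingSum_eq_zero_of_ncard_ne w hG (ne_of_lt ?_)
  rw [SimpleGraph.Subgraph.deleteVerts_verts, SimpleGraph.Subgraph.verts_top,
    ← Set.compl_eq_univ_sdiff, hVxy, Set.ncard_coe_finset, ← hcard, ← Set.ncard_coe_finset]
  exact Set.ncard_lt_ncard (Set.ssubset_iff_exists.2
    ⟨Set.inter_subset_left, x, hU.1, fun h ↦ h.2 (Set.mem_insert x _)⟩)

end Bipartite

theorem corollary3p7_general {α : Type*} [Fintype α] {R : Type*} [CommRing R]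
    {G : SimpleGraph α} (w : Sym2 α → R) {D : PlaneDrawing G} {F : Set ℂ} (hF : D.IsFace F)
    {a₁ b₁ a₂ b₂ : α} (hcyc : D.CyclicOnFace F a₁ b₁ a₂ b₂) (he : G.Adj a₂ b₂) :
    matchingSum w (⊤ : G.Subgraph) *
        matchingSum w (((⊤ : G.Subgraph).deleteVerts {a₁, b₁}).deleteEdges {s(a₂, b₂)}) =
      matchingSum w ((⊤ : G.Subgraph).deleteVerts {a₁, b₁}) *
          matchingSum w ((⊤ : G.Subgraph).deleteEdges {s(a₂, b₂)}) +
        w s(a₂, b₂) * matchingSum w ((⊤ : G.Subgraph).deleteVerts {a₁, a₂}) *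
          matchingSum w ((⊤ : G.Subgraph).deleteVerts {b₁, b₂}) -
        w s(a₂, b₂) * matchingSum w ((⊤ : G.Subgraph).deleteVerts {a₂, b₁}) *
          matchingSum w ((⊤ : G.Subgraph).deleteVerts {a₁, b₂}) := by
  have hnodup := hcyc.nodup
  have he' : ((⊤ : G.Subgraph).deleteVerts {a₁, b₁}).Adj a₂ b₂ := by
    simp only [SimpleGraph.Subgraph.deleteVerts_adj, SimpleGraph.Subgraph.verts_top, Set.mem_univ,
      SimpleGraph.Subgraph.top_adj]
    grind
  have hexpand := matchingSum_eq_deleteEdges_add_deleteVerts w (H := (⊤ : G.Subgraph)) he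
  have hexpand' := matchingSum_eq_deleteEdges_add_deleteVerts w he'
  rw [SimpleGraph.Subgraph.deleteVerts_deleteVerts, Set.insert_union, Set.singleton_union]
    at hexpand'
  have hcondensation := matchingSum_condensation w hnodup (hcyc.exists_mem_support_inter hF)
  rw [Set.pair_comm b₁ a₂] at hcondensation
  linear_combination
    matchingSum w ((⊤ : G.Subgraph).deleteVerts {a₁, b₁}) * hexpand -
      matchingSum w (⊤ : G.Subgraph) * hexpand' - w s(a₂, b₂) * hcondensation

theorem corollary3p7 {α : Type*} [Fintype α] {R : Type*} [CommRing R]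
    (G : SimpleGraph α) (w : Sym2 α → R) (D : PlaneDrawing G)
    (U V : Finset α) (hG : G.IsBipartiteWith (U : Set α) (V : Set α))
    (hcover : ∀ x, x ∈ U ∨ x ∈ V) (hcard : U.card = V.card)
    (a₁ b₁ a₂ b₂ : α) (he : G.Adj a₂ b₂)
    (F : Set ℂ) (hF : D.IsFace F) (hcyc : D.CyclicOnFace F a₁ b₁ a₂ b₂) :
    (((a₁ ∈ U ∧ b₂ ∈ U ∧ a₂ ∈ V ∧ b₁ ∈ V) ∨ (a₁ ∈ V ∧ b₂ ∈ V ∧ a₂ ∈ U ∧ b₁ ∈ U)) →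
      matchingSum w (⊤ : G.Subgraph) *
          matchingSum w (((⊤ : G.Subgraph).deleteVerts {a₁, b₁}).deleteEdges {s(a₂, b₂)}) =
        matchingSum w ((⊤ : G.Subgraph).deleteVerts {a₁, b₁}) *
            matchingSum w ((⊤ : G.Subgraph).deleteEdges {s(a₂, b₂)}) +
          w s(a₂, b₂) * matchingSum w ((⊤ : G.Subgraph).deleteVerts {a₁, a₂}) *
            matchingSum w ((⊤ : G.Subgraph).deleteVerts {b₁, b₂})) ∧
    (((a₁ ∈ U ∧ a₂ ∈ U ∧ b₁ ∈ V ∧ b₂ ∈ V) ∨ (a₁ ∈ V ∧ a₂ ∈ V ∧ b₁ ∈ U ∧ b₂ ∈ U)) →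
      matchingSum w (⊤ : G.Subgraph) *
          matchingSum w (((⊤ : G.Subgraph).deleteVerts {a₁, b₁}).deleteEdges {s(a₂, b₂)}) =
        matchingSum w ((⊤ : G.Subgraph).deleteVerts {a₁, b₁}) *
            matchingSum w ((⊤ : G.Subgraph).deleteEdges {s(a₂, b₂)}) -
          w s(a₂, b₂) * matchingSum w ((⊤ : G.Subgraph).deleteVerts {a₂, b₁}) *
            matchingSum w ((⊤ : G.Subgraph).deleteVerts {a₁, b₂})) := by
  rw [corollary3p7_general w hF hcyc he]
  refine ⟨fun h ↦ ?_, fun h ↦ ?_⟩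
  · rw [matchingSum_deleteVerts_pair_eq_zero w hG hcard (x := a₁) (y := b₂) (by tauto)]
    ring
  · rw [matchingSum_deleteVerts_pair_eq_zero w hG hcard (x := a₁) (y := a₂) (by tauto)]
    ring
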